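/- Let $M$ be a smooth manifold (not necessarily closed), and let $(g,\sigma)$ be a magnetic system on $M$: $g=\langle\cdot,\cdot\rangle$ is a Riemannian metric and $\sigma$ is a closed $2$-form on $M$. Let $\Omega$ be the Lorentz force, i.e. the skew-adjoint endomorphism of $TM$ with $\sigma(v,w)=\langle v,\Omega(w)\rangle$, let $\nabla$ be the Levi-Civita connection of $g$, $R(X,Y)Z=\nabla_X\nabla_YZ-\nabla_Y\nabla_XZ-\nabla_{[X,Y]}Z$ its curvature, and $\frac{D}{dt}$ the induced covariant derivative along curves. For $s>0$, a unit vector $v$ and $w\in v^\perp$, let $$(M^\Omega_s)_v(w)=s^2R(w,v)v-s(\nabla_w\Omega)(v)+\tfrac s2\big((\nabla_v\Omega)(w)-\langle(\nabla_v\Omega)(w),v\rangle v\big)+\tfrac34\langle w,\Omega(v)\rangle\Omega(v)-\tfrac14\Omega^2(w)-\tfrac14\langle\Omega(w),\Omega(v)\rangle v .$$ For a unit vector $v$ at a point $x$ and $w\in T_xM$, let $\widetilde\Omega_v(w)=\Omega(w)^\top+\Omega(w^\top)+\tfrac12\Omega(w^\perp)^\perp$, where $^\top$ and $^\perp$ are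 the orthogonal projections onto $\mathbb Rv$ and $v^\perp$. **Proposition 3.1.** Let $\gamma\colon I\to M$ be a $(g,\sigma)$-geodesic of speed $s>0$ on a nondegenerate interval $I$, i.e. a smooth curve with $\frac{D\dot\gamma}{dt}=\Omega(\dot\gamma)$ and $\|\dot\gamma\|=s$. Let $J$ be a normal $(g,\sigma)$-Jacobi field along $\gamma$, i.e. a smooth vector field along $\gamma$ with $$\frac{D^2J}{dt^2}+R(J,\dot\gamma)\dot\gamma=(\nabla_J\Omega)(\dot\gamma)+\Omega\Big(\frac{DJ}{dt}\Big)\quad\text{and}\quad\Big\langle\frac{DJ}{dt},\dot\gamma\Big\rangle=0 .$$ Let $J^\perp=J-s^{-2}\langle J,\dot\gamma\rangle\dot\gamma$, and let $\widetilde D V=\frac{DV}{dt}-\widetilde\Omega_{\dot\gamma/s}(V)$ for vector fields $V$ along $\gamma$. Then $$\widetilde D^2J^\perp+(M^\Omega_s)_{\dot\gamma/s}(J^\perp)=0\quad\text{on } I .$$ -/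

import Mathlib

open scoped Manifold ContDiff Topology Bundle
open Bundle

noncomputable section

namespace MagneticFlow

/-- A positive definite bilinear form `B` on a finite-dimensional space is nondegenerate. -/
theorem isInvertible_of_pos {E : Type*} [NormedAddCommGroup E] [NormedSpace ℝ E]
    [FiniteDimensional ℝ E] (B : E →L[ℝ] E →L[ℝ] ℝ) (hB : ∀ v, v ≠ 0 → 0 < B v v) :
    B.IsInvertible := by
  have hinj : Function.Injective (B : E →ₗ[ℝ] E →L[ℝ] ℝ) := by
    rw [injective_iff_map_eq_zero]
    intro v hv
    by_contra h
    have h1 := hB v h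
    have h2 : B v = 0 := hv
    rw [h2] at h1
    simp at h1
  have hdim : Module.finrank ℝ E = Module.finrank ℝ (E →L[ℝ] ℝ) := by
    rw [← (LinearMap.toContinuousLinearMap : (E →ₗ[ℝ] ℝ) ≃ₗ[ℝ] E →L[ℝ] ℝ).finrank_eq]
    exact Subspace.dual_finrank_eq.symm
  refine ⟨(LinearEquiv.ofInjectiveOfFinrankEq (B : E →ₗ[ℝ] E →L[ℝ] ℝ) hinj
    hdim).toContinuousLinearEquiv, ?_⟩
  ext v w
  rfl

section Coordinates

variable {E : Type*} [NormedAddCommGroup E] [NormedSpace ℝ E]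
  {M : Type*} [TopologicalSpace M] [ChartedSpace E M] [IsManifold 𝓘(ℝ, E) ∞ M]

/-- The differential at `y` of the preferred chart around `x`, as a map `T_y M → E`: it sends a
tangent vector at `y` to its components in that chart (for `y` in the chart domain). -/
def toCoord (x y : M) : TangentSpace 𝓘(ℝ, E) y →L[ℝ] E :=
  (trivializationAt E (TangentSpace 𝓘(ℝ, E) : M → Type _) x).continuousLinearMapAt ℝ y

/-- The inverse of `toCoord x y`: the tangent vector at `y` with given components in the preferred
chart around `x`. -/
def ofCoord (x y : M) : E →L[ℝ] TangentSpace 𝓘(ℝ, E) y :=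
  (trivializationAt E (TangentSpace 𝓘(ℝ, E) : M → Type _) x).symmL ℝ y

/-- The coordinate expression, in the preferred chart around `x` and at the coordinate point `p`,
of a field `B` of bilinear forms on the tangent spaces. -/
def bilinInChart (B : ∀ y : M, TangentSpace 𝓘(ℝ, E) y →L[ℝ] TangentSpace 𝓘(ℝ, E) y →L[ℝ] ℝ)
    (x : M) (p : E) : E →L[ℝ] E →L[ℝ] ℝ :=
  let y := (extChartAt 𝓘(ℝ, E) x).symm p
  (ContinuousLinearMap.precomp ℝ (ofCoord x y)) ∘L (B y) ∘L (ofCoord x y)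

/-- The coordinate expression, in the preferred chart around `x` and at the coordinate point `p`,
of a field `A` of endomorphisms of the tangent spaces. -/
def endoInChart (A : ∀ y : M, TangentSpace 𝓘(ℝ, E) y →L[ℝ] TangentSpace 𝓘(ℝ, E) y)
    (x : M) (p : E) : E →L[ℝ] E :=
  let y := (extChartAt 𝓘(ℝ, E) x).symm p
  (toCoord x y) ∘L (A y) ∘L (ofCoord x y)

/-- The exterior derivative at `x` of a 2-form `σ`, evaluated on vectors given by their components
`u v w` in the preferred chart around `x`:
`dσ(u, v, w) = ∂_u σ(v, w) + ∂_v σ(w, u) + ∂_w σ(u, v)`. -/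
def extDerivTwoForm
    (σ : ∀ y : M, TangentSpace 𝓘(ℝ, E) y →L[ℝ] TangentSpace 𝓘(ℝ, E) y →L[ℝ] ℝ)
    (x : M) (u v w : E) : ℝ :=
  let D := fderiv ℝ (bilinInChart σ x) (extChartAt 𝓘(ℝ, E) x x)
  D u v w + D v w u + D w u v

end Coordinates

variable (E : Type*) [NormedAddCommGroup E] [NormedSpace ℝ E]
  (M : Type*) [TopologicalSpace M] [ChartedSpace E M] [IsManifold 𝓘(ℝ, E) ∞ M]

/-- A magnetic system on `M`: a smooth Riemannian metric `g` together with a smooth closed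
2-form `σ`. -/
structure MagneticSystem where
  /-- the Riemannian metric -/
  g : ContMDiffRiemannianMetric 𝓘(ℝ, E) ∞ E (TangentSpace 𝓘(ℝ, E) : M → Type _)
  /-- the magnetic form -/
  σ : ∀ x : M, TangentSpace 𝓘(ℝ, E) x →L[ℝ] TangentSpace 𝓘(ℝ, E) x →L[ℝ] ℝ
  alternating : ∀ (x : M) (v : TangentSpace 𝓘(ℝ, E) x), σ x v v = 0
  smooth : ContMDiff 𝓘(ℝ, E) (𝓘(ℝ, E).prod 𝓘(ℝ, E →L[ℝ] E →L[ℝ] ℝ)) ∞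
    (fun x ↦ TotalSpace.mk' (E →L[ℝ] E →L[ℝ] ℝ) x (σ x))
  closed : ∀ (x : M) (u v w : E), extDerivTwoForm σ x u v w = 0

variable {E M}

namespace MagneticSystem

variable (S : MagneticSystem E M)

/-- The inner product `⟨v, w⟩` of the metric `g`. -/
def ip {x : M} (v w : TangentSpace 𝓘(ℝ, E) x) : ℝ := S.g.inner x v w

/-- The Lorentz force `Ω`, i.e. the endomorphism with `σ(v, w) = ⟨v, Ω w⟩` (see
`sigma_eq_ip_lorentz`): as `g` is symmetric and `σ` is skew, `Ω w` is the vector whose image under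
`T_x M → (T_x M)*`, `z ↦ ⟨z, ·⟩`, is the covector `-σ(w, ·)`. -/
def lorentz (x : M) : TangentSpace 𝓘(ℝ, E) x →L[ℝ] TangentSpace 𝓘(ℝ, E) x :=
  (S.g.inner x).inverse ∘L (-(S.σ x))

/-! ### The Levi-Civita connection -/

/-- The Christoffel symbols of the Levi-Civita connection of `g` in the preferred chart around `x`,
at the coordinate point `p`, as a bilinear map `Γ(u, v)`. With `G` the metric in the chart,
`G(Γ(u, v), w) = (∂_u G(v, w) + ∂_v G(u, w) - ∂_w G(u, v)) / 2` for every `w`. -/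
def christoffel (x : M) (p : E) (u v : E) : E :=
  let G := bilinInChart S.g.inner x
  let D := fderiv ℝ G p
  (G p).inverse ((1 / 2 : ℝ) • (D u v + D v u - (D.flip u).flip v))

/-- The covariant derivative `(∇_u Ω)(v)` of the Lorentz force, for `u v ∈ T_x M`; in coordinates
`(∇_u Ω) v = (∂_u Ω) v + Γ(u, Ω v) - Ω Γ(u, v)`. -/
def nablaLorentz (x : M) (u v : TangentSpace 𝓘(ℝ, E) x) : TangentSpace 𝓘(ℝ, E) x :=
  let p := extChartAt 𝓘(ℝ, E) x x
  let A := endoInChart S.lorentz x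
  let Γ := S.christoffel x
  let u' := toCoord x x u
  let v' := toCoord x x v
  ofCoord x x (fderiv ℝ A p u' v' + Γ p u' (A p v') - A p (Γ p u' v'))

/-- The Riemann curvature tensor
`R(u, v) w = ∇_u ∇_v w - ∇_v ∇_u w - ∇_[u, v] w` for `u v w ∈ T_x M`; in coordinates
`R(u, v) w = ∂_u Γ(v, w) - ∂_v Γ(u, w) + Γ(u, Γ(v, w)) - Γ(v, Γ(u, w))`. -/
def curvature (x : M) (u v w : TangentSpace 𝓘(ℝ, E) x) : TangentSpace 𝓘(ℝ, E) x :=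
  let p := extChartAt 𝓘(ℝ, E) x x
  let Γ := S.christoffel x
  let u' := toCoord x x u
  let v' := toCoord x x v
  let w' := toCoord x x w
  ofCoord x x (fderiv ℝ (fun q ↦ Γ q v' w') p u' - fderiv ℝ (fun q ↦ Γ q u' w') p v'
    + Γ p u' (Γ p v' w') - Γ p v' (Γ p u' w'))

/-! ### Curves and vector fields along them -/

/-- The velocity of the curve `γ` defined on the interval `T` (one-sided at endpoints in `T`). -/
def velocity (γ : ℝ → M) (T : Set ℝ) (t : ℝ) : TangentSpace 𝓘(ℝ, E) (γ t) :=
  mfderivWithin 𝓘(ℝ, ℝ) 𝓘(ℝ, E) γ T t (1 : ℝ)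

/-- `V` is a smooth vector field along the curve `γ`, defined on the interval `T`. -/
def IsSmoothAlong (γ : ℝ → M) (T : Set ℝ) (V : ∀ t, TangentSpace 𝓘(ℝ, E) (γ t)) : Prop :=
  ContMDiffOn 𝓘(ℝ, ℝ) (𝓘(ℝ, E).prod 𝓘(ℝ, E)) ∞
    (fun t ↦ (⟨γ t, V t⟩ : TangentBundle 𝓘(ℝ, E) M)) T

/-- The Levi-Civita covariant derivative `DV/dt` of a vector field `V` along `γ`, computed at time
`t` in the preferred chart around `γ t`: `DV/dt = dV/dt + Γ(γ̇, V)`. -/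
def covDeriv (γ : ℝ → M) (T : Set ℝ) (V : ∀ t, TangentSpace 𝓘(ℝ, E) (γ t)) (t : ℝ) :
    TangentSpace 𝓘(ℝ, E) (γ t) :=
  let x := γ t
  ofCoord x x (derivWithin (fun τ ↦ toCoord x (γ τ) (V τ)) T t
    + S.christoffel x (extChartAt 𝓘(ℝ, E) x x)
        (toCoord x x (velocity γ T t)) (toCoord x x (V t)))

/-- `γ` is a `(g, σ)`-geodesic on the interval `T`: a smooth curve with `Dγ̇/dt = Ω(γ̇)`. -/
structure IsMagneticGeodesic (γ : ℝ → M) (T : Set ℝ) : Prop where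
  smooth : ContMDiffOn 𝓘(ℝ, ℝ) 𝓘(ℝ, E) ∞ γ T
  eqn : ∀ t ∈ T, S.covDeriv γ T (velocity γ T) t = S.lorentz (γ t) (velocity γ T t)

/-- The curve `γ` has constant speed `s` on `T`. -/
def HasSpeed (γ : ℝ → M) (T : Set ℝ) (s : ℝ) : Prop :=
  ∀ t ∈ T, √(S.ip (velocity γ T t) (velocity γ T t)) = s

/-- `J` is a `(g, σ)`-Jacobi field along `γ`: a smooth vector field along `γ` with
`D²J/dt² + R(J, γ̇)γ̇ = (∇_J Ω)(γ̇) + Ω(DJ/dt)`. -/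
structure IsMagneticJacobi (γ : ℝ → M) (T : Set ℝ)
    (J : ∀ t, TangentSpace 𝓘(ℝ, E) (γ t)) : Prop where
  smooth : IsSmoothAlong γ T J
  eqn : ∀ t ∈ T,
    S.covDeriv γ T (S.covDeriv γ T J) t
        + S.curvature (γ t) (J t) (velocity γ T t) (velocity γ T t)
      = S.nablaLorentz (γ t) (J t) (velocity γ T t) + S.lorentz (γ t) (S.covDeriv γ T J t)

/-- The field `J` along `γ` is normal: `⟨DJ/dt, γ̇⟩ = 0`. -/
def IsNormal (γ : ℝ → M) (T : Set ℝ) (J : ∀ t, TangentSpace 𝓘(ℝ, E) (γ t)) : Prop :=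
  ∀ t ∈ T, S.ip (S.covDeriv γ T J t) (velocity γ T t) = 0

/-! ### Projections, the anisotropic Lorentz force, the magnetic curvature operator -/

/-- The orthogonal projection `w^⊤` of `w` onto the line `ℝ v` (for `v ≠ 0`). -/
def tang {x : M} (v w : TangentSpace 𝓘(ℝ, E) x) : TangentSpace 𝓘(ℝ, E) x :=
  (S.ip w v / S.ip v v) • v

/-- The orthogonal projection `w^⊥` of `w` onto `v^⊥` (for `v ≠ 0`). -/
def perp {x : M} (v w : TangentSpace 𝓘(ℝ, E) x) : TangentSpace 𝓘(ℝ, E) x :=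
  w - S.tang v w

/-- The anisotropic Lorentz force `Ω̃_v(w) = Ω(w)^⊤ + Ω(w^⊤) + (1/2) Ω(w^⊥)^⊥` of a unit vector
`v`, with projections onto `ℝ v` and `v^⊥`. -/
def anisoLorentz {x : M} (v w : TangentSpace 𝓘(ℝ, E) x) : TangentSpace 𝓘(ℝ, E) x :=
  S.tang v (S.lorentz x w) + S.lorentz x (S.tang v w)
    + (1 / 2 : ℝ) • S.perp v (S.lorentz x (S.perp v w))

/-- The twisted covariant derivative `D̃V = DV/dt - Ω̃_{γ̇/s}(V)` along a curve `γ` of speed `s`. -/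
def twistedDeriv (s : ℝ) (γ : ℝ → M) (T : Set ℝ) (V : ∀ t, TangentSpace 𝓘(ℝ, E) (γ t)) (t : ℝ) :
    TangentSpace 𝓘(ℝ, E) (γ t) :=
  S.covDeriv γ T V t - S.anisoLorentz (s⁻¹ • velocity γ T t) (V t)

/-- The operator `(R^Ω_s)_v` on `v^⊥`, for a unit vector `v`. -/
def RΩ (s : ℝ) {x : M} (v w : TangentSpace 𝓘(ℝ, E) x) : TangentSpace 𝓘(ℝ, E) x :=
  s ^ 2 • S.curvature x w v v - s • S.nablaLorentz x w v
    + (s / 2) • (S.nablaLorentz x v w - S.ip (S.nablaLorentz x v w) v • v)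

/-- The operator `(A^Ω)_v` on `v^⊥`, for a unit vector `v`. -/
def AΩ {x : M} (v w : TangentSpace 𝓘(ℝ, E) x) : TangentSpace 𝓘(ℝ, E) x :=
  (3 / 4 : ℝ) • (S.ip w (S.lorentz x v) • S.lorentz x v)
    - (1 / 4 : ℝ) • S.lorentz x (S.lorentz x w)
    - (1 / 4 : ℝ) • (S.ip (S.lorentz x w) (S.lorentz x v) • v)

/-- The magnetic curvature operator `(M^Ω_s)_v = (R^Ω_s)_v + (A^Ω)_v` at level `s` on `v^⊥`, for a
unit vector `v`. -/
def magCurvature (s : ℝ) {x : M} (v w : TangentSpace 𝓘(ℝ, E) x) : TangentSpace 𝓘(ℝ, E) x :=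
  S.RΩ s v w + S.AΩ v w

/-- The defining property `σ(v, w) = ⟨v, Ω w⟩` of the Lorentz force. -/
theorem sigma_eq_ip_lorentz [FiniteDimensional ℝ E] (x : M) (v w : TangentSpace 𝓘(ℝ, E) x) :
    S.σ x v w = S.ip v (S.lorentz x w) := by
  have hinv : (S.g.inner x).IsInvertible :=
    isInvertible_of_pos (E := E) (S.g.inner x) (S.g.pos x)
  have h1 : S.g.inner x (S.lorentz x w) = -(S.σ x w) := by
    simp only [lorentz, ContinuousLinearMap.comp_apply]
    obtain ⟨e, he⟩ := hinv
    rw [← he, ContinuousLinearMap.inverse_equiv]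
    simp
  have h2 : S.σ x v w + S.σ x w v = 0 := by
    have := S.alternating x (v + w)
    simp only [map_add, add_apply, S.alternating, zero_add, add_zero] at this
    linarith
  rw [ip, S.g.symm, h1]
  simp only [neg_apply]
  linarith

end MagneticSystem

end MagneticFlow

end

noncomputable section

set_option maxSynthPendingDepth 3

namespace MagneticFlow

/-! ### Tangent vectors and tensors in charts. -/

section Coordinates

variable {E : Type*} [NormedAddCommGroup E] [NormedSpace ℝ E]
  {M : Type*} [TopologicalSpace M] [ChartedSpace E M]

/-! Write `G` for the velocity, `k = s⁻²` and `W = J + f G` for the normal part, with `f = -k⟨J,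
G⟩`. Normality of `J` and the geodesic equation give `f' = k b`, where `b = ⟨ΩW, G⟩ = -⟨J, ΩG⟩`. On
vectors orthogonal to `G` the anisotropic force is `w ↦ ½ Ωw + ½ k⟨Ωw, G⟩ G`, so the twisted
derivative of `W` is `U = DW - ½ ΩW - ½ k b G`. Since `⟨DW, G⟩ = b`, the field `U` is again
orthogonal to `G`, and the same formula applies to the second derivative.

Expanding by the Leibniz rules and inserting the Jacobi equation for `J = W - f G`, all terms in `f`
cancel: `R(G, G)G = 0`, and the terms `(∇_G Ω)G` and `Ω²G` each occur with both signs. What remains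
is minus the magnetic curvature operator; for example, the coefficient 3/4 is `1 - 1/2 + 1/4`,
collected from the terms `k b ΩG`. Curvature enters only through the Jacobi equation.

The analytic work is in justifying these rules. `covDeriv` is computed at each time in the chart
centred at that point, so iterating it requires its expression in one fixed chart. This is
`toCoord_covDeriv`, which rests on the transformation law `fderiv_transition_christoffel`. The
calculus is then carried by `covDeriv_add`, `covDeriv_smul`, `covDeriv_lorentz` and the metric
compatibility `hasDerivWithinAt_ip`. -/

theorem extChartAt_left_inv {x y : M} (hy : y ∈ (chartAt E x).source) :
    (extChartAt 𝓘(ℝ, E) x).symm (extChartAt 𝓘(ℝ, E) x y) = y :=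
  (extChartAt 𝓘(ℝ, E) x).left_inv (by simpa using hy)

theorem extChartAt_mem_target {x y : M} (hy : y ∈ (chartAt E x).source) :
    extChartAt 𝓘(ℝ, E) x y ∈ (extChartAt 𝓘(ℝ, E) x).target :=
  (extChartAt 𝓘(ℝ, E) x).map_source (by simpa using hy)

theorem extChartAt_symm_mem_source {x : M} {p : E} (hp : p ∈ (extChartAt 𝓘(ℝ, E) x).target) :
    (extChartAt 𝓘(ℝ, E) x).symm p ∈ (chartAt E x).source := by
  simpa using (extChartAt 𝓘(ℝ, E) x).map_target hp

/-- The change of coordinates from the preferred chart around `x` to that around `x'`. -/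
def transition (x x' : M) : E → E := extChartAt 𝓘(ℝ, E) x' ∘ (extChartAt 𝓘(ℝ, E) x).symm

theorem transition_extChartAt {x y : M} (x' : M) (hy : y ∈ (chartAt E x).source) :
    transition x x' (extChartAt 𝓘(ℝ, E) x y) = extChartAt 𝓘(ℝ, E) x' y := by
  simp [transition, hy]

theorem eventually_mem_source {γ : ℝ → M} {T : Set ℝ}
    (hγ : ContMDiffOn 𝓘(ℝ, ℝ) 𝓘(ℝ, E) ∞ γ T) {x : M} {t : ℝ} (ht : t ∈ T)
    (hx : γ t ∈ (chartAt E x).source) : ∀ᶠ τ in 𝓝[T] t, γ τ ∈ (chartAt E x).source :=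
  (hγ t ht).continuousWithinAt.preimage_mem_nhdsWithin ((chartAt E x).open_source.mem_nhds hx)

variable [IsManifold 𝓘(ℝ, E) ∞ M]

theorem isManifold_one : IsManifold 𝓘(ℝ, E) 1 M :=
  IsManifold.of_le (n := ∞) (by simp)

theorem toCoord_ofCoord {x y : M} (hy : y ∈ (chartAt E x).source) (u : E) :
    toCoord x y (ofCoord x y u) = u :=
  (trivializationAt E (TangentSpace 𝓘(ℝ, E) : M → Type _) x).continuousLinearMapAt_symmL
    (R := ℝ) hy u

theorem ofCoord_toCoord {x y : M} (hy : y ∈ (chartAt E x).source) (v : TangentSpace 𝓘(ℝ, E) y) :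
    ofCoord x y (toCoord x y v) = v :=
  (trivializationAt E (TangentSpace 𝓘(ℝ, E) : M → Type _) x).symmL_continuousLinearMapAt
    (R := ℝ) hy v

theorem toCoord_eq_trivializationAt {x y : M} (hy : y ∈ (chartAt E x).source)
    (v : TangentSpace 𝓘(ℝ, E) y) :
    toCoord x y v = (trivializationAt E (TangentSpace 𝓘(ℝ, E) : M → Type _) x ⟨y, v⟩).2 :=
  (trivializationAt E (TangentSpace 𝓘(ℝ, E) : M → Type _) x).continuousLinearMapAt_apply_of_mem
    (R := ℝ) hy v

theorem toCoord_injective {x y : M} (hy : y ∈ (chartAt E x).source) :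
    Function.Injective (toCoord (E := E) x y) :=
  Function.LeftInverse.injective (ofCoord_toCoord hy)

theorem contDiffAt_transition {x x' y : M} (hy : y ∈ (chartAt E x).source)
    (hy' : y ∈ (chartAt E x').source) :
    ContDiffAt ℝ ∞ (transition x x') (extChartAt 𝓘(ℝ, E) x y) := by
  have h : extChartAt 𝓘(ℝ, E) x y ∈
      ((extChartAt 𝓘(ℝ, E) x).symm ≫ extChartAt 𝓘(ℝ, E) x').source := by
    rw [PartialEquiv.trans_source'', PartialEquiv.symm_symm, PartialEquiv.symm_target]
    exact Set.mem_image_of_mem _ ⟨by simpa using hy, by simpa using hy'⟩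
  have := contDiffWithinAt_ext_coord_change (I := 𝓘(ℝ, E)) (n := ∞) x' x h
  rw [modelWithCornersSelf_coe, Set.range_id, contDiffWithinAt_univ] at this
  exact this

theorem toCoord_eq_fderiv_transition {x x' y : M} (hy : y ∈ (chartAt E x).source)
    (hy' : y ∈ (chartAt E x').source) (v : TangentSpace 𝓘(ℝ, E) y) :
    toCoord x' y v
      = fderiv ℝ (transition x x') (extChartAt 𝓘(ℝ, E) x y) (toCoord x y v) := by
  have h1 := TangentBundle.continuousLinearMapAt_trivializationAt_eq_core (I := 𝓘(ℝ, E)) hy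
  have h2 := TangentBundle.continuousLinearMapAt_trivializationAt_eq_core (I := 𝓘(ℝ, E)) hy'
  have h3 := tangentCoordChange_comp (I := 𝓘(ℝ, E)) (w := y) (x := x) (y := x') (z := y) (v := v)
    ⟨⟨by simp, by simpa using hy⟩, by simpa using hy'⟩
  have h4 : tangentCoordChange 𝓘(ℝ, E) x x' y
      = fderiv ℝ (transition x x') (extChartAt 𝓘(ℝ, E) x y) := by
    rw [tangentCoordChange_def]
    simp [transition, fderivWithin_univ]
  rw [← h4, toCoord, h2, toCoord, h1]
  exact h3.symm

theorem toCoord_velocity {γ : ℝ → M} {T : Set ℝ} {t : ℝ} {x : M}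
    (hγ : MDifferentiableWithinAt 𝓘(ℝ, ℝ) 𝓘(ℝ, E) γ T t) (hT : UniqueDiffWithinAt ℝ T t)
    (hx : γ t ∈ (chartAt E x).source) :
    toCoord x (γ t) (MagneticSystem.velocity γ T t)
      = derivWithin (fun τ ↦ extChartAt 𝓘(ℝ, E) x (γ τ)) T t := by
  have : IsManifold 𝓘(ℝ, E) 1 M := isManifold_one
  have h1 := TangentBundle.continuousLinearMapAt_trivializationAt (I := 𝓘(ℝ, E)) hx
  have h2 := mfderiv_comp_mfderivWithin (I := 𝓘(ℝ, ℝ)) (I' := 𝓘(ℝ, E)) (I'' := 𝓘(ℝ, E)) t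
    (g := extChartAt 𝓘(ℝ, E) x) (f := γ) (s := T) (mdifferentiableAt_extChartAt hx) hγ
    hT.uniqueMDiffWithinAt
  rw [toCoord, h1, MagneticSystem.velocity, ← fderivWithin_derivWithin]
  rw [mfderivWithin_eq_fderivWithin] at h2
  have h3 := congrArg (fun L : ℝ →L[ℝ] E ↦ L 1) h2
  exact h3.symm

theorem isSmoothAlong_iff {γ : ℝ → M} {T : Set ℝ} {V : ∀ t, TangentSpace 𝓘(ℝ, E) (γ t)}
    (hγ : ContMDiffOn 𝓘(ℝ, ℝ) 𝓘(ℝ, E) ∞ γ T) :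
    MagneticSystem.IsSmoothAlong γ T V ↔
      ∀ t ∈ T, ContDiffWithinAt ℝ ∞ (fun τ ↦ toCoord (γ t) (γ τ) (V τ)) T t := by
  refine forall₂_congr fun t ht ↦ ?_
  rw [Bundle.contMDiffWithinAt_totalSpace, and_iff_right (hγ t ht),
    contMDiffWithinAt_iff_contDiffWithinAt]
  refine Filter.EventuallyEq.congr_contDiffWithinAt_of_mem ?_ ht
  have := (hγ t ht).continuousWithinAt.preimage_mem_nhdsWithin
    ((chartAt E (γ t)).open_source.mem_nhds (mem_chart_source E (γ t)))
  filter_upwards [this] with τ hτ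
  exact (toCoord_eq_trivializationAt hτ (V τ)).symm

/-- Frees the smoothness criterion from the chart centred at `γ t`; this is needed to compare charts
at nearby times. -/
theorem MagneticSystem.IsSmoothAlong.contDiffWithinAt {γ : ℝ → M} {T : Set ℝ}
    {V : ∀ t, TangentSpace 𝓘(ℝ, E) (γ t)} (hV : IsSmoothAlong γ T V) {x : M} {t : ℝ} (ht : t ∈ T)
    (hx : γ t ∈ (chartAt E x).source) :
    ContDiffWithinAt ℝ ∞ (fun τ ↦ toCoord x (γ τ) (V τ)) T t := by
  have h : ContMDiffWithinAt 𝓘(ℝ, ℝ) (𝓘(ℝ, E).prod 𝓘(ℝ, E)) ∞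
    (fun t ↦ (⟨γ t, V t⟩ : TangentBundle 𝓘(ℝ, E) M)) T t := hV t ht
  rw [Bundle.Trivialization.contMDiffWithinAt_iff
    (e := trivializationAt E (TangentSpace 𝓘(ℝ, E) : M → Type _) x)
    (f := fun t ↦ (⟨γ t, V t⟩ : TangentBundle 𝓘(ℝ, E) M))
    (((trivializationAt E (TangentSpace 𝓘(ℝ, E) : M → Type _) x).mem_source (x := ⟨γ t, V t⟩)).2
      hx),
    contMDiffWithinAt_iff_contDiffWithinAt] at h
  refine (Filter.EventuallyEq.congr_contDiffWithinAt_of_mem ?_ ht).1 h.2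
  have := h.1.continuousWithinAt.preimage_mem_nhdsWithin
    ((chartAt E x).open_source.mem_nhds hx)
  filter_upwards [this] with τ hτ
  exact (toCoord_eq_trivializationAt hτ (V τ)).symm

theorem contDiffWithinAt_extChartAt_comp {γ : ℝ → M} {T : Set ℝ}
    (hγ : ContMDiffOn 𝓘(ℝ, ℝ) 𝓘(ℝ, E) ∞ γ T) {x : M} {t : ℝ} (ht : t ∈ T)
    (hx : γ t ∈ (chartAt E x).source) :
    ContDiffWithinAt ℝ ∞ (fun τ ↦ extChartAt 𝓘(ℝ, E) x (γ τ)) T t := by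
  rw [← contMDiffWithinAt_iff_contDiffWithinAt]
  exact (contMDiffAt_extChartAt' hx).comp_contMDiffWithinAt t (hγ t ht)

theorem contMDiffOn_ofCoord (x : M) (u : E) :
    ContMDiffOn 𝓘(ℝ, E) (𝓘(ℝ, E).prod 𝓘(ℝ, E)) ∞
      (fun y ↦ (⟨y, ofCoord x y u⟩ : TangentBundle 𝓘(ℝ, E) M)) (chartAt E x).source := by
  refine ((trivializationAt E (TangentSpace 𝓘(ℝ, E) : M → Type _)
    x).contMDiffOn_section_baseSet_iff (IB := 𝓘(ℝ, E)) (n := ∞)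
    (s := fun y ↦ ofCoord x y u)).2 ?_
  refine (contMDiffOn_const (c := u)).congr fun y hy ↦ ?_
  rw [← toCoord_eq_trivializationAt hy, toCoord_ofCoord hy]

theorem bilinInChart_extChartAt
    (B : ∀ y : M, TangentSpace 𝓘(ℝ, E) y →L[ℝ] TangentSpace 𝓘(ℝ, E) y →L[ℝ] ℝ)
    {x y : M} (hy : y ∈ (chartAt E x).source) (v w : TangentSpace 𝓘(ℝ, E) y) :
    bilinInChart B x (extChartAt 𝓘(ℝ, E) x y) (toCoord x y v) (toCoord x y w) = B y v w := by
  -- The inverse chart returns `y` only up to a proved equality on which the fibre depends, so the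
  -- base point is generalised before substituting.
  have h : ∀ z, z = y → ∀ v w : TangentSpace 𝓘(ℝ, E) y,
      B z (ofCoord x z (toCoord x y v)) (ofCoord x z (toCoord x y w)) = B y v w := by
    rintro z rfl v w
    rw [ofCoord_toCoord hy, ofCoord_toCoord hy]
  exact h _ (extChartAt_left_inv hy) v w

theorem endoInChart_extChartAt
    (A : ∀ y : M, TangentSpace 𝓘(ℝ, E) y →L[ℝ] TangentSpace 𝓘(ℝ, E) y)
    {x y : M} (hy : y ∈ (chartAt E x).source) (v : TangentSpace 𝓘(ℝ, E) y) :
    endoInChart A x (extChartAt 𝓘(ℝ, E) x y) (toCoord x y v) = toCoord x y (A y v) := by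
  have h : ∀ z, z = y → ∀ v : TangentSpace 𝓘(ℝ, E) y,
      toCoord x z (A z (ofCoord x z (toCoord x y v))) = toCoord x y (A y v) := by
    rintro z rfl v
    rw [ofCoord_toCoord hy]
  exact h _ (extChartAt_left_inv hy) v

/-- In finite dimension, smoothness of a map into bilinear forms can be tested on fixed pairs of
vectors, that is, on the coordinate fields `ofCoord x · u`, which are smooth sections. -/
theorem contDiffOn_bilinInChart [FiniteDimensional ℝ E]
    (B : ∀ y : M, TangentSpace 𝓘(ℝ, E) y →L[ℝ] TangentSpace 𝓘(ℝ, E) y →L[ℝ] ℝ)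
    (hB : ContMDiff 𝓘(ℝ, E) (𝓘(ℝ, E).prod 𝓘(ℝ, E →L[ℝ] E →L[ℝ] ℝ)) ∞
      (fun x ↦ TotalSpace.mk' (E →L[ℝ] E →L[ℝ] ℝ) x (B x))) (x : M) :
    ContDiffOn ℝ ∞ (bilinInChart B x) (extChartAt 𝓘(ℝ, E) x).target := by
  refine contDiffOn_clm_apply.2 fun u ↦ contDiffOn_clm_apply.2 fun v ↦ ?_
  have h : ContMDiffOn 𝓘(ℝ, E) 𝓘(ℝ, ℝ) ∞ (fun y ↦ B y (ofCoord x y u) (ofCoord x y v))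
      (chartAt E x).source := by
    intro y hy
    have : ContMDiffWithinAt 𝓘(ℝ, E) (𝓘(ℝ, E).prod 𝓘(ℝ, ℝ)) ∞
        (fun y ↦ TotalSpace.mk' ℝ (E := Bundle.Trivial M ℝ) y
          (B y (ofCoord x y u) (ofCoord x y v))) (chartAt E x).source y := by
      apply ContMDiffWithinAt.clm_bundle_apply₂ (F₁ := E) (F₂ := E)
      · exact hB.contMDiffAt.contMDiffWithinAt
      · exact contMDiffOn_ofCoord x u y hy
      · exact contMDiffOn_ofCoord x v y hy
    rw [Bundle.contMDiffWithinAt_totalSpace] at this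
    exact this.2
  rw [← contMDiffOn_iff_contDiffOn]
  exact h.comp (contMDiffOn_extChartAt_symm x) fun p hp ↦ extChartAt_symm_mem_source hp

end Coordinates

/-! ### Bilinearity of the Koszul covector. -/

section Koszul

variable {E : Type*} [NormedAddCommGroup E] [NormedSpace ℝ E]

/-- The covector `w ↦ (D(u, v, w) + D(v, u, w) - D(w, u, v)) / 2`. -/
def koszulForm (D : E →L[ℝ] E →L[ℝ] E →L[ℝ] ℝ) (u v : E) : E →L[ℝ] ℝ :=
  (1 / 2 : ℝ) • (D u v + D v u - (D.flip u).flip v)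

theorem koszulForm_apply (D : E →L[ℝ] E →L[ℝ] E →L[ℝ] ℝ) (u v w : E) :
    koszulForm D u v w = (D u v w + D v u w - D w u v) / 2 := by
  rw [koszulForm, smul_apply, sub_apply, add_apply, ContinuousLinearMap.flip_apply,
    ContinuousLinearMap.flip_apply, smul_eq_mul]
  ring

theorem koszulForm_add_left (D : E →L[ℝ] E →L[ℝ] E →L[ℝ] ℝ) (u u' v : E) :
    koszulForm D (u + u') v = koszulForm D u v + koszulForm D u' v := by
  ext w
  rw [add_apply, koszulForm_apply, koszulForm_apply, koszulForm_apply, D.map_add,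
    (D v).map_add, (D w).map_add, add_apply, add_apply, add_apply, add_apply]
  ring

theorem koszulForm_smul_left (D : E →L[ℝ] E →L[ℝ] E →L[ℝ] ℝ) (c : ℝ) (u v : E) :
    koszulForm D (c • u) v = c • koszulForm D u v := by
  ext w
  rw [smul_apply, koszulForm_apply, koszulForm_apply, D.map_smul,
    (D v).map_smul, (D w).map_smul, smul_apply, smul_apply, smul_apply, smul_apply]
  simp only [smul_eq_mul]
  ring

theorem koszulForm_add_right (D : E →L[ℝ] E →L[ℝ] E →L[ℝ] ℝ) (u v v' : E) :
    koszulForm D u (v + v') = koszulForm D u v + koszulForm D u v' := by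
  ext w
  rw [add_apply, koszulForm_apply, koszulForm_apply, koszulForm_apply, D.map_add,
    (D u).map_add, (D w u).map_add, add_apply, add_apply, add_apply]
  ring

theorem koszulForm_smul_right (D : E →L[ℝ] E →L[ℝ] E →L[ℝ] ℝ) (c : ℝ) (u v : E) :
    koszulForm D u (c • v) = c • koszulForm D u v := by
  ext w
  rw [smul_apply, koszulForm_apply, koszulForm_apply, D.map_smul,
    (D u).map_smul, (D w u).map_smul, smul_apply, smul_apply, smul_apply]
  simp only [smul_eq_mul]
  ring

end Koszul

/-! ### Derivatives of bilinear forms and of their pullbacks. -/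

theorem hasFDerivAt_bilin_apply {E F : Type*} [NormedAddCommGroup E] [NormedSpace ℝ E]
    [NormedAddCommGroup F] [NormedSpace ℝ F]
    {B : E → F →L[ℝ] F →L[ℝ] ℝ} {B' : E →L[ℝ] F →L[ℝ] F →L[ℝ] ℝ} {f g : E → F} {f' g' : E →L[ℝ] F}
    {p : E} (hB : HasFDerivAt B B' p) (hf : HasFDerivAt f f' p) (hg : HasFDerivAt g g' p) :
    HasFDerivAt (fun q ↦ B q (f q) (g q))
      ((B p (f p)).comp g' + ((B p).comp f' + B'.flip (f p)).flip (g p)) p :=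
  (hB.clm_apply hf).clm_apply hg

/-- Product rule for `G = φ^* G'`. The two terms with the second derivative of `φ` are the source of
the inhomogeneous term in the law for Christoffel symbols. -/
theorem fderiv_pullback_bilin {E : Type*} [NormedAddCommGroup E] [NormedSpace ℝ E]
    {G G' : E → E →L[ℝ] E →L[ℝ] ℝ} {φ : E → E} {p : E} (hφ : ContDiffAt ℝ 2 φ p)
    (hG : DifferentiableAt ℝ G p) (hG' : DifferentiableAt ℝ G' (φ p))
    (h : ∀ᶠ q in 𝓝 p, ∀ a b, G q a b = G' (φ q) (fderiv ℝ φ q a) (fderiv ℝ φ q b)) (w a b : E) :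
    fderiv ℝ G p w a b
      = fderiv ℝ G' (φ p) (fderiv ℝ φ p w) (fderiv ℝ φ p a) (fderiv ℝ φ p b)
        + G' (φ p) (fderiv ℝ (fderiv ℝ φ) p w a) (fderiv ℝ φ p b)
        + G' (φ p) (fderiv ℝ φ p a) (fderiv ℝ (fderiv ℝ φ) p w b) := by
  have hφ1 : HasFDerivAt φ (fderiv ℝ φ p) p := (hφ.differentiableAt (by simp)).hasFDerivAt
  have hφ2 : HasFDerivAt (fderiv ℝ φ) (fderiv ℝ (fderiv ℝ φ) p) p :=
    ((hφ.fderiv_right (m := 1) (by norm_num)).differentiableAt (by simp)).hasFDerivAt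
  have hφ3 : ∀ a, HasFDerivAt (fun q ↦ fderiv ℝ φ q a) ((fderiv ℝ (fderiv ℝ φ) p).flip a) p := by
    intro a
    simpa using hφ2.clm_apply (hasFDerivAt_const a p)
  have d1 := hasFDerivAt_bilin_apply hG.hasFDerivAt (hasFDerivAt_const a p) (hasFDerivAt_const b p)
  have d2 := hasFDerivAt_bilin_apply (hG'.hasFDerivAt.comp p hφ1) (hφ3 a) (hφ3 b)
  have d3 := d1.unique (d2.congr_of_eventuallyEq (h.mono fun q hq ↦ hq a b))
  have d4 := congrArg (fun L : E →L[ℝ] ℝ ↦ L w) d3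
  simp only [add_apply, ContinuousLinearMap.comp_apply, ContinuousLinearMap.flip_apply,
    zero_apply, map_zero, zero_add, Function.comp_apply] at d4
  linarith

/-! ### Metric, Christoffel symbols and Lorentz force in a chart. -/

namespace MagneticSystem

variable {E : Type*} [NormedAddCommGroup E] [NormedSpace ℝ E]
  {M : Type*} [TopologicalSpace M] [ChartedSpace E M] [IsManifold 𝓘(ℝ, E) ∞ M]
  (S : MagneticSystem E M)

theorem metric_symm (x : M) (p u v : E) :
    bilinInChart S.g.inner x p u v = bilinInChart S.g.inner x p v u :=
  S.g.symm _ _ _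

variable [FiniteDimensional ℝ E]

theorem metric_isInvertible {x : M} {p : E} (hp : p ∈ (extChartAt 𝓘(ℝ, E) x).target) :
    (bilinInChart S.g.inner x p).IsInvertible := by
  refine isInvertible_of_pos _ fun v hv ↦ ?_
  refine S.g.pos _ _ fun h ↦ hv ?_
  exact (toCoord_ofCoord (extChartAt_symm_mem_source hp) v).symm.trans
    ((congrArg (toCoord x _) h).trans (map_zero _))

theorem contDiffOn_metric (x : M) :
    ContDiffOn ℝ ∞ (bilinInChart S.g.inner x) (extChartAt 𝓘(ℝ, E) x).target :=
  contDiffOn_bilinInChart _ S.g.contMDiff x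

theorem differentiableAt_metric {x : M} {p : E} (hp : p ∈ (extChartAt 𝓘(ℝ, E) x).target) :
    DifferentiableAt ℝ (bilinInChart S.g.inner x) p :=
  ((S.contDiffOn_metric x).contDiffAt ((isOpen_extChartAt_target x).mem_nhds hp)).differentiableAt
    (by simp)

theorem fderiv_metric_symm {x : M} {p : E} (hp : p ∈ (extChartAt 𝓘(ℝ, E) x).target) (w u v : E) :
    fderiv ℝ (bilinInChart S.g.inner x) p w u v = fderiv ℝ (bilinInChart S.g.inner x) p w v u := by
  have h := (S.differentiableAt_metric hp).hasFDerivAt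
  have h1 : ∀ u v, HasFDerivAt (fun q ↦ bilinInChart S.g.inner x q u v)
      (((fderiv ℝ (bilinInChart S.g.inner x) p).flip u).flip v) p := by
    intro u v
    refine ((h.clm_apply (hasFDerivAt_const u p)).clm_apply (hasFDerivAt_const v p)).congr_fderiv ?_
    ext w
    simp
  have h2 := (h1 u v).unique ((h1 v u).congr_of_eventuallyEq
    (Filter.Eventually.of_forall fun q ↦ S.metric_symm x q u v))
  simpa using congrArg (fun L : E →L[ℝ] ℝ ↦ L w) h2

/-- The Koszul formula in a chart. -/
theorem metric_christoffel {x : M} {p : E} (hp : p ∈ (extChartAt 𝓘(ℝ, E) x).target) (u v w : E) :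
    bilinInChart S.g.inner x p (S.christoffel x p u v) w
      = (fderiv ℝ (bilinInChart S.g.inner x) p u v w
        + fderiv ℝ (bilinInChart S.g.inner x) p v u w
        - fderiv ℝ (bilinInChart S.g.inner x) p w u v) / 2 := by
  have h : koszulForm (fderiv ℝ (bilinInChart S.g.inner x) p) u v
      = bilinInChart S.g.inner x p (S.christoffel x p u v) :=
    (S.metric_isInvertible hp).inverse_apply_eq.1 rfl
  rw [← h, koszulForm_apply]

/-- The Christoffel symbols as a continuous bilinear map. -/
def christoffelCLM (x : M) (p : E) : E →L[ℝ] E →L[ℝ] E :=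
  LinearMap.toContinuousBilinearMap (LinearMap.mk₂ ℝ (S.christoffel x p)
    (fun u u' v ↦ (congrArg _ (koszulForm_add_left _ u u' v)).trans
      ((bilinInChart S.g.inner x p).inverse.map_add _ _))
    (fun c u v ↦ (congrArg _ (koszulForm_smul_left _ c u v)).trans
      ((bilinInChart S.g.inner x p).inverse.map_smul _ _))
    (fun u v v' ↦ (congrArg _ (koszulForm_add_right _ u v v')).trans
      ((bilinInChart S.g.inner x p).inverse.map_add _ _))
    (fun c u v ↦ (congrArg _ (koszulForm_smul_right _ c u v)).trans
      ((bilinInChart S.g.inner x p).inverse.map_smul _ _)))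

theorem christoffelCLM_apply (x : M) (p u v : E) :
    S.christoffelCLM x p u v = S.christoffel x p u v :=
  rfl

theorem contDiffOn_christoffelCLM (x : M) :
    ContDiffOn ℝ ∞ (S.christoffelCLM x) (extChartAt 𝓘(ℝ, E) x).target := by
  have hG := S.contDiffOn_metric x
  have hD := hG.fderiv_of_isOpen (m := ∞) (isOpen_extChartAt_target x) (by simp)
  have hi : ContDiffOn ℝ ∞ (fun p ↦ (bilinInChart S.g.inner x p).inverse)
      (extChartAt 𝓘(ℝ, E) x).target := fun p hp ↦
    ((S.metric_isInvertible hp).contDiffAt_map_inverse).comp_contDiffWithinAt p (hG p hp)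
  have hD' : ∀ u v w, ContDiffOn ℝ ∞ (fun p ↦ fderiv ℝ (bilinInChart S.g.inner x) p u v w)
      (extChartAt 𝓘(ℝ, E) x).target := fun u v w ↦
    ((hD.clm_apply contDiffOn_const).clm_apply contDiffOn_const).clm_apply contDiffOn_const
  refine contDiffOn_clm_apply.2 fun u ↦ contDiffOn_clm_apply.2 fun v ↦ ?_
  refine hi.clm_apply (g := fun p ↦ koszulForm (fderiv ℝ (bilinInChart S.g.inner x) p) u v)
    (contDiffOn_clm_apply.2 fun w ↦ ?_)
  simp only [koszulForm_apply]
  exact (((hD' u v w).add (hD' v u w)).sub (hD' w u v)).div_const 2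

theorem endoInChart_lorentz {x : M} {p : E} (hp : p ∈ (extChartAt 𝓘(ℝ, E) x).target) :
    endoInChart S.lorentz x p
      = (bilinInChart S.g.inner x p).inverse ∘L (-(bilinInChart S.σ x p)) := by
  ext u
  refine Eq.symm ?_
  rw [ContinuousLinearMap.comp_apply, (S.metric_isInvertible hp).inverse_apply_eq]
  ext w
  have hy := extChartAt_symm_mem_source hp
  have h1 := S.sigma_eq_ip_lorentz ((extChartAt 𝓘(ℝ, E) x).symm p)
    (ofCoord x _ w) (ofCoord x _ u)
  have h2 := S.alternating ((extChartAt 𝓘(ℝ, E) x).symm p) (ofCoord x _ w + ofCoord x _ u)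
  simp only [map_add, add_apply, S.alternating, zero_add, add_zero] at h2
  have h3 : bilinInChart S.g.inner x p (endoInChart S.lorentz x p u) w
      = S.ip (ofCoord x _ w) (S.lorentz ((extChartAt 𝓘(ℝ, E) x).symm p) (ofCoord x _ u)) := by
    rw [ip, S.g.symm]
    change S.g.inner _ (ofCoord x _ (toCoord x _ (S.lorentz _ (ofCoord x _ u)))) _ = _
    rw [ofCoord_toCoord hy]
    rfl
  rw [h3, ← h1]
  simp only [neg_apply, bilinInChart, ContinuousLinearMap.comp_apply,
    ContinuousLinearMap.precomp_apply]
  linarith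

theorem contDiffOn_lorentz (x : M) :
    ContDiffOn ℝ ∞ (endoInChart S.lorentz x) (extChartAt 𝓘(ℝ, E) x).target := by
  have hi : ContDiffOn ℝ ∞ (fun p ↦ (bilinInChart S.g.inner x p).inverse)
      (extChartAt 𝓘(ℝ, E) x).target := fun p hp ↦
    ((S.metric_isInvertible hp).contDiffAt_map_inverse).comp_contDiffWithinAt p
      (S.contDiffOn_metric x p hp)
  exact (hi.clm_comp (contDiffOn_bilinInChart _ S.smooth x).neg).congr fun p hp ↦
    S.endoInChart_lorentz hp

/-- The transformation law of the Christoffel symbols. -/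
theorem fderiv_transition_christoffel {x x' y : M} (hy : y ∈ (chartAt E x).source)
    (hy' : y ∈ (chartAt E x').source) (u v : E) :
    fderiv ℝ (transition x x') (extChartAt 𝓘(ℝ, E) x y)
        (S.christoffel x (extChartAt 𝓘(ℝ, E) x y) u v)
      = S.christoffel x' (extChartAt 𝓘(ℝ, E) x' y)
          (fderiv ℝ (transition x x') (extChartAt 𝓘(ℝ, E) x y) u)
          (fderiv ℝ (transition x x') (extChartAt 𝓘(ℝ, E) x y) v)
        + fderiv ℝ (fderiv ℝ (transition x x')) (extChartAt 𝓘(ℝ, E) x y) u v := by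
  set p := extChartAt 𝓘(ℝ, E) x y with hp
  set p' := extChartAt 𝓘(ℝ, E) x' y with hp'
  set φ : E → E := transition x x'
  have hpt : p ∈ (extChartAt 𝓘(ℝ, E) x).target := extChartAt_mem_target hy
  have hpt' : p' ∈ (extChartAt 𝓘(ℝ, E) x').target := extChartAt_mem_target hy'
  have hφp : φ p = p' := transition_extChartAt x' hy
  have hφ : ContDiffAt ℝ ∞ φ p := contDiffAt_transition hy hy'
  have hpull : ∀ᶠ q in 𝓝 p, ∀ a b, bilinInChart S.g.inner x q a b
      = bilinInChart S.g.inner x' (φ q) (fderiv ℝ φ q a) (fderiv ℝ φ q b) := by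
    have h1 : ∀ᶠ q in 𝓝 p, q ∈ (extChartAt 𝓘(ℝ, E) x).target :=
      (isOpen_extChartAt_target x).mem_nhds hpt
    have h2 : ∀ᶠ q in 𝓝 p, (extChartAt 𝓘(ℝ, E) x).symm q ∈ (chartAt E x').source := by
      have hc : ContinuousAt (extChartAt 𝓘(ℝ, E) x).symm p := continuousAt_extChartAt_symm'' hpt
      refine hc.preimage_mem_nhds ((chartAt E x').open_source.mem_nhds ?_)
      rwa [hp, extChartAt_left_inv hy]
    filter_upwards [h1, h2] with q hq1 hq2 a b
    have hz := extChartAt_symm_mem_source hq1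
    have hq : extChartAt 𝓘(ℝ, E) x ((extChartAt 𝓘(ℝ, E) x).symm q) = q :=
      (extChartAt 𝓘(ℝ, E) x).right_inv hq1
    have e1 := bilinInChart_extChartAt S.g.inner hz (ofCoord x _ a) (ofCoord x _ b)
    have e2 := bilinInChart_extChartAt S.g.inner hq2 (ofCoord x _ a) (ofCoord x _ b)
    rw [toCoord_eq_fderiv_transition hz hq2, toCoord_eq_fderiv_transition hz hq2,
      toCoord_ofCoord hz, toCoord_ofCoord hz, hq] at e2
    rw [toCoord_ofCoord hz, toCoord_ofCoord hz, hq] at e1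
    rw [e1, ← e2]
    rfl
  -- By this symmetry, four of the six second-derivative terms in the Koszul combination cancel, and
  -- the other two add up to twice `G'(D²φ(u, v), Dφ w)`.
  have hsymm : ∀ a b, fderiv ℝ (fderiv ℝ φ) p a b = fderiv ℝ (fderiv ℝ φ) p b a :=
    fun a b ↦ hφ.isSymmSndFDerivAt (by rw [minSmoothness_of_isRCLikeNormedField]; norm_cast) a b
  have hderiv : ∀ w a b, fderiv ℝ (bilinInChart S.g.inner x) p w a b
      = fderiv ℝ (bilinInChart S.g.inner x') p' (fderiv ℝ φ p w) (fderiv ℝ φ p a) (fderiv ℝ φ p b)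
        + bilinInChart S.g.inner x' p' (fderiv ℝ (fderiv ℝ φ) p w a) (fderiv ℝ φ p b)
        + bilinInChart S.g.inner x' p' (fderiv ℝ φ p a) (fderiv ℝ (fderiv ℝ φ) p w b) := by
    intro w a b
    have h := fderiv_pullback_bilin (hφ.of_le (by norm_cast)) (S.differentiableAt_metric hpt)
      (by rw [hφp]; exact S.differentiableAt_metric hpt') hpull w a b
    rwa [hφp] at h
  have hinj := (S.metric_isInvertible hpt').injective
  apply hinj
  ext w'
  -- The differential of the transition map is onto, so testing against its values suffices.
  obtain ⟨w, rfl⟩ : ∃ w, fderiv ℝ φ p w = w' := by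
    refine ⟨toCoord x y (ofCoord x' y w'), ?_⟩
    rw [← toCoord_eq_fderiv_transition hy hy', toCoord_ofCoord hy']
  have hp1 : ∀ a b, bilinInChart S.g.inner x p a b
      = bilinInChart S.g.inner x' p' (fderiv ℝ φ p a) (fderiv ℝ φ p b) := by
    intro a b
    rw [hpull.self_of_nhds a b, hφp]
  rw [← hp1, S.metric_christoffel hpt, hderiv, hderiv, hderiv, map_add, add_apply,
    S.metric_christoffel hpt', hsymm v u, hsymm w u, hsymm w v,
    S.metric_symm x' p' (fderiv ℝ φ p v), S.metric_symm x' p' (fderiv ℝ φ p u) _]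
  ring

end MagneticSystem

/-! ### Product rules along a curve. -/

section Calculus

variable {E F G : Type*} [NormedAddCommGroup E] [NormedSpace ℝ E]
  [NormedAddCommGroup F] [NormedSpace ℝ F] [NormedAddCommGroup G] [NormedSpace ℝ G]
  {c : ℝ → E} {c' : E} {v w : ℝ → F} {v' w' : F} {T : Set ℝ} {t : ℝ}

theorem hasDerivWithinAt_clm_comp_apply {A : E → F →L[ℝ] G} {A' : E →L[ℝ] F →L[ℝ] G}
    (hA : HasFDerivAt A A' (c t)) (hc : HasDerivWithinAt c c' T t)
    (hv : HasDerivWithinAt v v' T t) :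
    HasDerivWithinAt (fun τ ↦ A (c τ) (v τ)) (A' c' (v t) + A (c t) v') T t :=
  (hA.comp_hasDerivWithinAt t hc).clm_apply hv

theorem hasDerivWithinAt_bilin_comp_apply {B : E → F →L[ℝ] F →L[ℝ] G}
    {B' : E →L[ℝ] F →L[ℝ] F →L[ℝ] G}
    (hB : HasFDerivAt B B' (c t)) (hc : HasDerivWithinAt c c' T t)
    (hv : HasDerivWithinAt v v' T t) (hw : HasDerivWithinAt w w' T t) :
    HasDerivWithinAt (fun τ ↦ B (c τ) (v τ) (w τ))
      (B' c' (v t) (w t) + B (c t) v' (w t) + B (c t) (v t) w') T t :=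
  (hasDerivWithinAt_clm_comp_apply hB hc hv).clm_apply hw

end Calculus

namespace MagneticSystem

variable {E : Type*} [NormedAddCommGroup E] [NormedSpace ℝ E]
  {M : Type*} [TopologicalSpace M] [ChartedSpace E M] [IsManifold 𝓘(ℝ, E) ∞ M]
  {γ : ℝ → M} {T : Set ℝ} {V W : ∀ t, TangentSpace 𝓘(ℝ, E) (γ t)} {f : ℝ → ℝ} {t : ℝ}

/-! ### Smooth vector fields along a curve -/

theorem IsSmoothAlong.hasDerivWithinAt (hV : IsSmoothAlong γ T V) (ht : t ∈ T) {x : M}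
    (hx : γ t ∈ (chartAt E x).source) :
    HasDerivWithinAt (fun τ ↦ toCoord x (γ τ) (V τ))
      (derivWithin (fun τ ↦ toCoord x (γ τ) (V τ)) T t) T t :=
  ((hV.contDiffWithinAt ht hx).differentiableWithinAt (by simp)).hasDerivWithinAt

theorem hasDerivWithinAt_extChartAt_comp (hγ : ContMDiffOn 𝓘(ℝ, ℝ) 𝓘(ℝ, E) ∞ γ T) (ht : t ∈ T)
    {x : M} (hx : γ t ∈ (chartAt E x).source) :
    HasDerivWithinAt (fun τ ↦ extChartAt 𝓘(ℝ, E) x (γ τ))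
      (derivWithin (fun τ ↦ extChartAt 𝓘(ℝ, E) x (γ τ)) T t) T t :=
  ((contDiffWithinAt_extChartAt_comp hγ ht hx).differentiableWithinAt (by simp)).hasDerivWithinAt

theorem IsSmoothAlong.add (hγ : ContMDiffOn 𝓘(ℝ, ℝ) 𝓘(ℝ, E) ∞ γ T) (hV : IsSmoothAlong γ T V)
    (hW : IsSmoothAlong γ T W) : IsSmoothAlong γ T (fun τ ↦ V τ + W τ) := by
  refine (isSmoothAlong_iff hγ).2 fun t ht ↦ ?_
  simp only [map_add]
  exact ((isSmoothAlong_iff hγ).1 hV t ht).add ((isSmoothAlong_iff hγ).1 hW t ht)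

theorem IsSmoothAlong.smul (hγ : ContMDiffOn 𝓘(ℝ, ℝ) 𝓘(ℝ, E) ∞ γ T) (hf : ContDiffOn ℝ ∞ f T)
    (hV : IsSmoothAlong γ T V) : IsSmoothAlong γ T (fun τ ↦ f τ • V τ) := by
  refine (isSmoothAlong_iff hγ).2 fun t ht ↦ ?_
  simp only [map_smul]
  exact (hf t ht).smul ((isSmoothAlong_iff hγ).1 hV t ht)

theorem isSmoothAlong_velocity (hγ : ContMDiffOn 𝓘(ℝ, ℝ) 𝓘(ℝ, E) ∞ γ T) (hT : UniqueDiffOn ℝ T) :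
    IsSmoothAlong (E := E) γ T (velocity γ T) := by
  refine (isSmoothAlong_iff hγ).2 fun t ht ↦ ?_
  have hx := mem_chart_source E (γ t)
  have hc := contDiffWithinAt_extChartAt_comp hγ ht hx
  refine (Filter.EventuallyEq.congr_contDiffWithinAt_of_mem ?_ ht).2
    (hc.derivWithin hT (m := ∞) (by simp) ht)
  filter_upwards [eventually_mem_source hγ ht hx, self_mem_nhdsWithin]
    with τ hτ hτT
  have hγτ := (hγ τ hτT).mdifferentiableWithinAt (n := ∞) (by simp)
  exact toCoord_velocity hγτ (hT τ hτT) hτ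

variable [FiniteDimensional ℝ E] (S : MagneticSystem E M)

theorem IsSmoothAlong.lorentz (hγ : ContMDiffOn 𝓘(ℝ, ℝ) 𝓘(ℝ, E) ∞ γ T)
    (hV : IsSmoothAlong γ T V) : IsSmoothAlong γ T (fun τ ↦ S.lorentz (γ τ) (V τ)) := by
  refine (isSmoothAlong_iff hγ).2 fun t ht ↦ ?_
  have hx := mem_chart_source E (γ t)
  have hA := ((S.contDiffOn_lorentz (γ t)).contDiffAt
    ((isOpen_extChartAt_target (γ t)).mem_nhds (extChartAt_mem_target hx))).comp_contDiffWithinAt t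
    (contDiffWithinAt_extChartAt_comp hγ ht hx)
  refine (Filter.EventuallyEq.congr_contDiffWithinAt_of_mem ?_ ht).2
    (hA.clm_apply ((isSmoothAlong_iff hγ).1 hV t ht))
  filter_upwards [eventually_mem_source hγ ht hx] with τ hτ
  exact (endoInChart_extChartAt S.lorentz hτ (V τ)).symm

theorem contDiffOn_ip (hγ : ContMDiffOn 𝓘(ℝ, ℝ) 𝓘(ℝ, E) ∞ γ T) (hV : IsSmoothAlong γ T V)
    (hW : IsSmoothAlong γ T W) : ContDiffOn ℝ ∞ (fun τ ↦ S.ip (V τ) (W τ)) T := by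
  intro t ht
  have hx := mem_chart_source E (γ t)
  have hG := ((S.contDiffOn_metric (γ t)).contDiffAt
    ((isOpen_extChartAt_target (γ t)).mem_nhds (extChartAt_mem_target hx))).comp_contDiffWithinAt t
    (contDiffWithinAt_extChartAt_comp hγ ht hx)
  refine (Filter.EventuallyEq.congr_contDiffWithinAt_of_mem ?_ ht).2
    ((hG.clm_apply ((isSmoothAlong_iff hγ).1 hV t ht)).clm_apply
      ((isSmoothAlong_iff hγ).1 hW t ht))
  filter_upwards [eventually_mem_source hγ ht hx] with τ hτ
  exact (bilinInChart_extChartAt S.g.inner hτ (V τ) (W τ)).symm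

/-! ### The covariant derivative along a curve -/

/-- The coordinate expression of the covariant derivative in an arbitrary preferred chart. -/
theorem toCoord_covDeriv (hγ : ContMDiffOn 𝓘(ℝ, ℝ) 𝓘(ℝ, E) ∞ γ T) (hT : UniqueDiffOn ℝ T)
    (hV : IsSmoothAlong γ T V) (ht : t ∈ T) {x : M} (hx : γ t ∈ (chartAt E x).source) :
    toCoord x (γ t) (S.covDeriv γ T V t)
      = derivWithin (fun τ ↦ toCoord x (γ τ) (V τ)) T t
        + S.christoffelCLM x (extChartAt 𝓘(ℝ, E) x (γ t))
          (derivWithin (fun τ ↦ extChartAt 𝓘(ℝ, E) x (γ τ)) T t) (toCoord x (γ t) (V t)) := by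
  have hx' := mem_chart_source E (γ t)
  have hγt := (hγ t ht).mdifferentiableWithinAt (n := ∞) (by simp)
  have hc := hasDerivWithinAt_extChartAt_comp hγ ht hx
  have hφ : ContDiffAt ℝ ∞ (transition x (γ t)) (extChartAt 𝓘(ℝ, E) x (γ t)) :=
    contDiffAt_transition hx hx'
  have hφ2 := ((hφ.fderiv_right (m := 1) (by norm_cast)).differentiableAt (by simp)).hasFDerivAt
  -- Differentiating the change of components produces a second derivative of the transition map,
  -- exactly the one in the Christoffel transformation law.
  have hV' : derivWithin (fun τ ↦ toCoord (γ t) (γ τ) (V τ)) T t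
      = fderiv ℝ (fderiv ℝ (transition x (γ t))) (extChartAt 𝓘(ℝ, E) x (γ t))
          (derivWithin (fun τ ↦ extChartAt 𝓘(ℝ, E) x (γ τ)) T t) (toCoord x (γ t) (V t))
        + fderiv ℝ (transition x (γ t)) (extChartAt 𝓘(ℝ, E) x (γ t))
          (derivWithin (fun τ ↦ toCoord x (γ τ) (V τ)) T t) := by
    refine HasDerivWithinAt.derivWithin ?_ (hT t ht)
    refine (hasDerivWithinAt_clm_comp_apply hφ2 hc
      (hV.hasDerivWithinAt ht hx)).congr_of_eventuallyEq_of_mem ?_ ht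
    filter_upwards [eventually_mem_source hγ ht hx, eventually_mem_source hγ ht hx'] with τ h1 h2
    exact toCoord_eq_fderiv_transition h1 h2 (V τ)
  set a := derivWithin (fun τ ↦ toCoord x (γ τ) (V τ)) T t
        + S.christoffelCLM x (extChartAt 𝓘(ℝ, E) x (γ t))
          (derivWithin (fun τ ↦ extChartAt 𝓘(ℝ, E) x (γ τ)) T t) (toCoord x (γ t) (V t)) with ha
  suffices h : S.covDeriv γ T V t = ofCoord x (γ t) a by rw [h, toCoord_ofCoord hx]
  apply toCoord_injective hx'
  rw [toCoord_eq_fderiv_transition hx hx' (ofCoord x (γ t) a), toCoord_ofCoord hx, covDeriv,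
    toCoord_ofCoord hx', hV', toCoord_eq_fderiv_transition hx hx' (velocity γ T t),
    toCoord_eq_fderiv_transition hx hx' (V t), toCoord_velocity hγt (hT t ht) hx, ha, map_add,
    christoffelCLM_apply, S.fderiv_transition_christoffel hx hx']
  abel

theorem IsSmoothAlong.covDeriv (hγ : ContMDiffOn 𝓘(ℝ, ℝ) 𝓘(ℝ, E) ∞ γ T) (hT : UniqueDiffOn ℝ T)
    (hV : IsSmoothAlong γ T V) : IsSmoothAlong γ T (S.covDeriv γ T V) := by
  refine (isSmoothAlong_iff hγ).2 fun t ht ↦ ?_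
  have hx := mem_chart_source E (γ t)
  have hc := contDiffWithinAt_extChartAt_comp hγ ht hx
  have hΓ := ((S.contDiffOn_christoffelCLM (γ t)).contDiffAt
    ((isOpen_extChartAt_target (γ t)).mem_nhds (extChartAt_mem_target hx))).comp_contDiffWithinAt t
    hc
  have hV' := (isSmoothAlong_iff hγ).1 hV t ht
  refine (Filter.EventuallyEq.congr_contDiffWithinAt_of_mem ?_ ht).2
    ((hV'.derivWithin hT (m := ∞) (by simp) ht).add
      ((hΓ.clm_apply (hc.derivWithin hT (m := ∞) (by simp) ht)).clm_apply hV'))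
  filter_upwards [eventually_mem_source hγ ht hx, self_mem_nhdsWithin] with τ hτ hτT
  exact S.toCoord_covDeriv hγ hT hV hτT hτ

theorem toCoord_covDeriv_self (V : ∀ t, TangentSpace 𝓘(ℝ, E) (γ t)) (t : ℝ) :
    toCoord (γ t) (γ t) (S.covDeriv γ T V t)
      = derivWithin (fun τ ↦ toCoord (γ t) (γ τ) (V τ)) T t
        + S.christoffelCLM (γ t) (extChartAt 𝓘(ℝ, E) (γ t) (γ t))
          (toCoord (γ t) (γ t) (velocity γ T t)) (toCoord (γ t) (γ t) (V t)) :=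
  toCoord_ofCoord (mem_chart_source E (γ t)) _

/-- The derivative within `T` sees only values on `T`. This matters because the explicit formulas
for the normal part and its twisted derivative are established only there. -/
theorem covDeriv_congr (h : ∀ τ ∈ T, V τ = W τ) (ht : t ∈ T) :
    S.covDeriv γ T V t = S.covDeriv γ T W t := by
  apply toCoord_injective (mem_chart_source E (γ t))
  rw [toCoord_covDeriv_self, toCoord_covDeriv_self, h t ht]
  congr 1
  exact derivWithin_congr (fun τ hτ ↦ by rw [h τ hτ]) (by rw [h t ht])

theorem covDeriv_add (hT : UniqueDiffOn ℝ T)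
    (hV : IsSmoothAlong γ T V) (hW : IsSmoothAlong γ T W) (ht : t ∈ T) :
    S.covDeriv γ T (fun τ ↦ V τ + W τ) t = S.covDeriv γ T V t + S.covDeriv γ T W t := by
  have hx := mem_chart_source E (γ t)
  have h := ((hV.hasDerivWithinAt ht hx).add (hW.hasDerivWithinAt ht hx)).derivWithin (hT t ht)
  apply toCoord_injective hx
  rw [map_add, toCoord_covDeriv_self, toCoord_covDeriv_self, toCoord_covDeriv_self]
  simp only [map_add]
  refine (congrArg₂ _ h rfl).trans ?_
  abel

theorem covDeriv_smul (hT : UniqueDiffOn ℝ T) (hV : IsSmoothAlong γ T V) {f' : ℝ}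
    (hf : HasDerivWithinAt f f' T t) (ht : t ∈ T) :
    S.covDeriv γ T (fun τ ↦ f τ • V τ) t = f t • S.covDeriv γ T V t + f' • V t := by
  have hx := mem_chart_source E (γ t)
  have h := (hf.smul (hV.hasDerivWithinAt ht hx)).derivWithin (hT t ht)
  apply toCoord_injective hx
  rw [map_add, map_smul, map_smul, toCoord_covDeriv_self, toCoord_covDeriv_self]
  simp only [map_smul]
  refine (congrArg₂ _ h rfl).trans ?_
  module

theorem covDeriv_const_smul (hT : UniqueDiffOn ℝ T) (hV : IsSmoothAlong γ T V) (c : ℝ)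
    (ht : t ∈ T) : S.covDeriv γ T (fun τ ↦ c • V τ) t = c • S.covDeriv γ T V t := by
  rw [S.covDeriv_smul hT hV (hasDerivWithinAt_const t T c) ht, zero_smul, add_zero]

theorem nablaLorentz_eq (x : M) (u v : TangentSpace 𝓘(ℝ, E) x) :
    S.nablaLorentz x u v = ofCoord x x
      (fderiv ℝ (endoInChart S.lorentz x) (extChartAt 𝓘(ℝ, E) x x) (toCoord x x u) (toCoord x x v)
        + S.christoffelCLM x (extChartAt 𝓘(ℝ, E) x x) (toCoord x x u)
          (endoInChart S.lorentz x (extChartAt 𝓘(ℝ, E) x x) (toCoord x x v))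
        - endoInChart S.lorentz x (extChartAt 𝓘(ℝ, E) x x)
          (S.christoffelCLM x (extChartAt 𝓘(ℝ, E) x x) (toCoord x x u) (toCoord x x v))) :=
  rfl

theorem covDeriv_lorentz (hγ : ContMDiffOn 𝓘(ℝ, ℝ) 𝓘(ℝ, E) ∞ γ T) (hT : UniqueDiffOn ℝ T)
    (hV : IsSmoothAlong γ T V) (ht : t ∈ T) :
    S.covDeriv γ T (fun τ ↦ S.lorentz (γ τ) (V τ)) t
      = S.nablaLorentz (γ t) (velocity γ T t) (V t) + S.lorentz (γ t) (S.covDeriv γ T V t) := by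
  have hx := mem_chart_source E (γ t)
  have hγt := (hγ t ht).mdifferentiableWithinAt (n := ∞) (by simp)
  have hA := (((S.contDiffOn_lorentz (γ t)).contDiffAt
    ((isOpen_extChartAt_target (γ t)).mem_nhds (extChartAt_mem_target hx))).differentiableAt
    (by simp)).hasFDerivAt
  have hc := hasDerivWithinAt_extChartAt_comp hγ ht hx
  have h := HasDerivWithinAt.derivWithin ((hasDerivWithinAt_clm_comp_apply hA hc
    (hV.hasDerivWithinAt ht hx)).congr_of_eventuallyEq_of_mem
    (f₁ := fun τ ↦ toCoord (γ t) (γ τ) (S.lorentz (γ τ) (V τ)))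
    ((eventually_mem_source hγ ht hx).mono fun τ hτ ↦
      (endoInChart_extChartAt S.lorentz hτ (V τ)).symm) ht) (hT t ht)
  apply toCoord_injective hx
  rw [toCoord_covDeriv_self, h, map_add, nablaLorentz_eq, toCoord_ofCoord hx,
    ← endoInChart_extChartAt S.lorentz hx, ← endoInChart_extChartAt S.lorentz hx,
    toCoord_covDeriv_self, toCoord_velocity hγt (hT t ht) hx, map_add]
  abel

/-- Metric compatibility: by the Koszul formula the two Christoffel terms add up to the derivative
of the metric coefficients along the curve. -/
theorem hasDerivWithinAt_ip (hγ : ContMDiffOn 𝓘(ℝ, ℝ) 𝓘(ℝ, E) ∞ γ T) (hT : UniqueDiffOn ℝ T)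
    (hV : IsSmoothAlong γ T V) (hW : IsSmoothAlong γ T W) (ht : t ∈ T) :
    HasDerivWithinAt (fun τ ↦ S.ip (V τ) (W τ))
      (S.ip (S.covDeriv γ T V t) (W t) + S.ip (V t) (S.covDeriv γ T W t)) T t := by
  have hx := mem_chart_source E (γ t)
  have hp := extChartAt_mem_target hx
  have hγt := (hγ t ht).mdifferentiableWithinAt (n := ∞) (by simp)
  have hG := (S.differentiableAt_metric hp).hasFDerivAt
  have hc := hasDerivWithinAt_extChartAt_comp hγ ht hx
  have h := hasDerivWithinAt_bilin_comp_apply hG hc (hV.hasDerivWithinAt ht hx)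
    (hW.hasDerivWithinAt ht hx)
  refine (h.congr_of_eventuallyEq_of_mem ?_ ht).congr_deriv ?_
  · filter_upwards [eventually_mem_source hγ ht hx] with τ hτ
    exact (bilinInChart_extChartAt S.g.inner hτ (V τ) (W τ)).symm
  · rw [ip, ip, ← bilinInChart_extChartAt S.g.inner hx, ← bilinInChart_extChartAt S.g.inner hx,
      toCoord_covDeriv_self, toCoord_covDeriv_self, toCoord_velocity hγt (hT t ht) hx]
    simp only [map_add, add_apply, christoffelCLM_apply]
    rw [S.metric_symm _ _ (toCoord (γ t) (γ t) (V t)) (S.christoffel _ _ _ _),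
      S.metric_christoffel hp, S.metric_christoffel hp,
      S.fderiv_metric_symm hp _ (toCoord (γ t) (γ t) (W t)) (toCoord (γ t) (γ t) (V t))]
    ring

/-! ### Tensoriality -/

/-- Moves the evaluation at fixed vectors outside the derivative of the symbols, which makes
multilinearity visible. -/
theorem curvature_eq (x : M) (u v w : TangentSpace 𝓘(ℝ, E) x) :
    S.curvature x u v w = ofCoord x x
      (fderiv ℝ (S.christoffelCLM x) (extChartAt 𝓘(ℝ, E) x x) (toCoord x x u) (toCoord x x v)
          (toCoord x x w)
        - fderiv ℝ (S.christoffelCLM x) (extChartAt 𝓘(ℝ, E) x x) (toCoord x x v) (toCoord x x u)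
          (toCoord x x w)
        + S.christoffelCLM x (extChartAt 𝓘(ℝ, E) x x) (toCoord x x u)
          (S.christoffelCLM x (extChartAt 𝓘(ℝ, E) x x) (toCoord x x v) (toCoord x x w))
        - S.christoffelCLM x (extChartAt 𝓘(ℝ, E) x x) (toCoord x x v)
          (S.christoffelCLM x (extChartAt 𝓘(ℝ, E) x x) (toCoord x x u) (toCoord x x w))) := by
  have hΓ := (((S.contDiffOn_christoffelCLM x).contDiffAt
    ((isOpen_extChartAt_target x).mem_nhds
      (extChartAt_mem_target (mem_chart_source E x)))).differentiableAt (by simp)).hasFDerivAt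
  have h : ∀ a b c, fderiv ℝ (fun q ↦ S.christoffel x q a b) (extChartAt 𝓘(ℝ, E) x x) c
      = fderiv ℝ (S.christoffelCLM x) (extChartAt 𝓘(ℝ, E) x x) c a b := by
    intro a b c
    have h1 := ((hΓ.clm_apply (hasFDerivAt_const a _)).clm_apply (hasFDerivAt_const b _)).fderiv
    have h2 := congrArg (fun L : E →L[ℝ] E ↦ L c) h1
    simpa using! h2
  simp only [curvature, h, christoffelCLM_apply]

theorem curvature_add_left (x : M) (u u' v w : TangentSpace 𝓘(ℝ, E) x) :
    S.curvature x (u + u') v w = S.curvature x u v w + S.curvature x u' v w := by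
  simp only [curvature_eq, ← map_add]
  congr 1
  simp only [map_add, add_apply]
  abel

theorem curvature_smul_left (x : M) (c : ℝ) (u v w : TangentSpace 𝓘(ℝ, E) x) :
    S.curvature x (c • u) v w = c • S.curvature x u v w := by
  simp only [curvature_eq, ← map_smul]
  congr 1
  simp only [map_smul, smul_apply]
  module

theorem curvature_smul_middle (x : M) (c : ℝ) (u v w : TangentSpace 𝓘(ℝ, E) x) :
    S.curvature x u (c • v) w = c • S.curvature x u v w := by
  simp only [curvature_eq, ← map_smul]
  congr 1
  simp only [map_smul, smul_apply]
  module

theorem curvature_smul_right (x : M) (c : ℝ) (u v w : TangentSpace 𝓘(ℝ, E) x) :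
    S.curvature x u v (c • w) = c • S.curvature x u v w := by
  simp only [curvature_eq, ← map_smul]
  congr 1
  simp only [map_smul]
  module

omit [FiniteDimensional ℝ E] in
theorem curvature_self (x : M) (v w : TangentSpace 𝓘(ℝ, E) x) : S.curvature x v v w = 0 := by
  simp [curvature]

theorem nablaLorentz_add_left (x : M) (u u' v : TangentSpace 𝓘(ℝ, E) x) :
    S.nablaLorentz x (u + u') v = S.nablaLorentz x u v + S.nablaLorentz x u' v := by
  simp only [nablaLorentz_eq, ← map_add]
  congr 1
  simp only [map_add, add_apply]
  abel

theorem nablaLorentz_smul_left (x : M) (c : ℝ) (u v : TangentSpace 𝓘(ℝ, E) x) :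
    S.nablaLorentz x (c • u) v = c • S.nablaLorentz x u v := by
  simp only [nablaLorentz_eq, ← map_smul]
  congr 1
  simp only [map_smul, smul_apply]
  module

theorem nablaLorentz_smul_right (x : M) (c : ℝ) (u v : TangentSpace 𝓘(ℝ, E) x) :
    S.nablaLorentz x u (c • v) = c • S.nablaLorentz x u v := by
  simp only [nablaLorentz_eq, ← map_smul]
  congr 1
  simp only [map_smul]
  module

/-! ### Pointwise algebra -/

variable {x : M}

omit [FiniteDimensional ℝ E] in
theorem ip_add_left (u v w : TangentSpace 𝓘(ℝ, E) x) : S.ip (u + v) w = S.ip u w + S.ip v w := by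
  simp only [ip, map_add, add_apply]

omit [FiniteDimensional ℝ E] in
theorem ip_smul_left (c : ℝ) (u v : TangentSpace 𝓘(ℝ, E) x) :
    S.ip (c • u) v = c * S.ip u v := by
  simp only [ip, map_smul, smul_apply, smul_eq_mul]

omit [FiniteDimensional ℝ E] in
theorem ip_smul_right (c : ℝ) (u v : TangentSpace 𝓘(ℝ, E) x) :
    S.ip u (c • v) = c * S.ip u v := by
  simp only [ip, map_smul, smul_eq_mul]

omit [FiniteDimensional ℝ E] in
theorem ip_comm (u v : TangentSpace 𝓘(ℝ, E) x) : S.ip u v = S.ip v u :=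
  S.g.symm x u v

/-- The Lorentz force is skew-adjoint. -/
theorem ip_lorentz_left (u v : TangentSpace 𝓘(ℝ, E) x) :
    S.ip (S.lorentz x u) v = -S.ip u (S.lorentz x v) := by
  have h := S.alternating x (u + v)
  simp only [map_add, add_apply, S.alternating, zero_add, add_zero, sigma_eq_ip_lorentz] at h
  rw [ip_comm]
  linarith

theorem ip_lorentz_self (v : TangentSpace 𝓘(ℝ, E) x) :
    S.ip (S.lorentz x v) v = 0 := by
  have h := S.ip_lorentz_left v v
  rw [S.ip_comm v] at h
  linarith

omit [FiniteDimensional ℝ E] in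
-- Here the tangential part of `w` vanishes, and `Ω(w)^⊤ + ½ Ω(w)^⊥ = ½ Ω(w) + ½ Ω(w)^⊤`.
theorem anisoLorentz_of_ip_eq_zero {v w : TangentSpace 𝓘(ℝ, E) x} (hv : S.ip v v = 1)
    (hw : S.ip w v = 0) :
    S.anisoLorentz v w
      = (1 / 2 : ℝ) • S.lorentz x w + (1 / 2 * S.ip (S.lorentz x w) v) • v := by
  simp only [anisoLorentz, perp, tang, hv, hw, div_one, zero_smul, sub_zero, map_zero]
  module

/-- Rewrites the operator in terms of the velocity instead of its unit direction. The weights `s²`,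
`s`, `s/2` absorb the homogeneity in `v`, and `s⁻²` survives only where `v` occurs two more times.
-/
theorem magCurvature_inv_smul {s : ℝ} (hs : s ≠ 0)
    (v w : TangentSpace 𝓘(ℝ, E) x) :
    S.magCurvature s (s⁻¹ • v) w
      = S.curvature x w v v - S.nablaLorentz x w v + (1 / 2 : ℝ) • S.nablaLorentz x v w
        - (1 / 2 * (s ^ 2)⁻¹ * S.ip (S.nablaLorentz x v w) v) • v
        + (3 / 4 * (s ^ 2)⁻¹ * S.ip w (S.lorentz x v)) • S.lorentz x v
        - (1 / 4 : ℝ) • S.lorentz x (S.lorentz x w)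
        - (1 / 4 * (s ^ 2)⁻¹ * S.ip (S.lorentz x w) (S.lorentz x v)) • v := by
  simp only [magCurvature, RΩ, AΩ, curvature_smul_middle, curvature_smul_right,
    nablaLorentz_smul_left, nablaLorentz_smul_right, map_smul, ip_smul_left, ip_smul_right]
  (match_scalars <;> field_simp); ring

/-- The normal part of a normal magnetic Jacobi field satisfies the Jacobi equation of the twisted
derivative, with the magnetic curvature operator in place of the curvature. -/
theorem twistedDeriv_twistedDeriv_perp {T : Set ℝ} (hU : UniqueDiffOn ℝ T)
    {γ : ℝ → M} (hγ : S.IsMagneticGeodesic γ T) {s : ℝ} (hs : 0 < s) (hspeed : S.HasSpeed γ T s)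
    {J : ∀ t, TangentSpace 𝓘(ℝ, E) (γ t)} (hJ : S.IsMagneticJacobi γ T J)
    (hnormal : S.IsNormal γ T J) :
    ∀ t ∈ T,
      S.twistedDeriv s γ T (S.twistedDeriv s γ T (fun τ ↦ S.perp (velocity γ T τ) (J τ))) t
        + S.magCurvature s (s⁻¹ • velocity γ T t) (S.perp (velocity γ T t) (J t)) = 0 := by
  have hγs := hγ.smooth
  set G : ∀ τ, TangentSpace 𝓘(ℝ, E) (γ τ) := velocity γ T with hG
  have hGs : IsSmoothAlong (E := E) γ T G := isSmoothAlong_velocity hγs hU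
  have hGG : ∀ τ ∈ T, S.ip (G τ) (G τ) = s ^ 2 := fun τ hτ ↦
    (Real.sqrt_eq_iff_mul_self_eq_of_pos hs).1 (hspeed τ hτ) ▸ (sq s).symm
  set k : ℝ := (s ^ 2)⁻¹ with hk
  have hks : k * s ^ 2 = 1 := inv_mul_cancel₀ (by positivity)
  have hG1 : ∀ τ ∈ T, S.ip (s⁻¹ • G τ) (s⁻¹ • G τ) = 1 := by
    intro τ hτ
    rw [S.ip_smul_left, S.ip_smul_right, hGG τ hτ]
    field_simp
  set f : ℝ → ℝ := fun τ ↦ -k * S.ip (J τ) (G τ) with hf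
  have hfs : ContDiffOn ℝ ∞ f T := contDiffOn_const.mul (S.contDiffOn_ip hγs hJ.smooth hGs)
  set W : ∀ τ, TangentSpace 𝓘(ℝ, E) (γ τ) := fun τ ↦ J τ + f τ • G τ with hW
  have hWs : IsSmoothAlong γ T W := hJ.smooth.add hγs (hGs.smul hγs hfs)
  have hperp : ∀ τ ∈ T, S.perp (G τ) (J τ) = W τ := by
    intro τ hτ
    simp only [perp, tang, hGG τ hτ, hW, hf, hk]
    module
  have hWG : ∀ τ ∈ T, S.ip (W τ) (G τ) = 0 := by
    intro τ hτ
    simp only [hW, hf, S.ip_add_left, S.ip_smul_left, hGG τ hτ]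
    linear_combination (-S.ip (J τ) (G τ)) * hks
  set b : ℝ → ℝ := fun τ ↦ S.ip (S.lorentz (γ τ) (W τ)) (G τ) with hb
  have hLWs := hWs.lorentz S hγs
  have hLGs := hGs.lorentz S hγs
  have hbs : ContDiffOn ℝ ∞ b T := S.contDiffOn_ip hγs hLWs hGs
  have hbJ : ∀ τ, b τ = -S.ip (J τ) (S.lorentz (γ τ) (G τ)) := by
    intro τ
    have h := S.ip_lorentz_self (G τ)
    rw [S.ip_comm] at h
    simp only [hb, S.ip_lorentz_left, hW, S.ip_add_left, S.ip_smul_left, h, mul_zero, add_zero]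
  have hDG : ∀ τ ∈ T, S.covDeriv γ T G τ = S.lorentz (γ τ) (G τ) := hγ.eqn
  have hf' : ∀ τ ∈ T, HasDerivWithinAt f (k * b τ) T τ := by
    intro τ hτ
    refine ((S.hasDerivWithinAt_ip hγs hU hJ.smooth hGs hτ).const_mul (-k)).congr_deriv ?_
    rw [hnormal τ hτ, hDG τ hτ, hbJ]
    ring
  have hDJs := hJ.smooth.covDeriv S hγs hU
  have hDW : ∀ τ ∈ T, S.covDeriv γ T W τ
      = S.covDeriv γ T J τ + (f τ • S.lorentz (γ τ) (G τ) + (k * b τ) • G τ) := by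
    intro τ hτ
    rw [hW, S.covDeriv_add hU hJ.smooth (hGs.smul hγs hfs) hτ,
      S.covDeriv_smul hU hGs (hf' τ hτ) hτ, hDG τ hτ]
  have hDWs := hWs.covDeriv S hγs hU
  set U : ∀ τ, TangentSpace 𝓘(ℝ, E) (γ τ) := fun τ ↦ S.covDeriv γ T W τ
    + ((-(1 / 2) : ℝ) • S.lorentz (γ τ) (W τ) + (-(1 / 2) * k * b τ) • G τ) with hUdef
  have haniso : ∀ τ ∈ T, ∀ w : TangentSpace 𝓘(ℝ, E) (γ τ), S.ip w (G τ) = 0 →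
      S.anisoLorentz (s⁻¹ • G τ) w = (1 / 2 : ℝ) • S.lorentz (γ τ) w
        + (1 / 2 * k * S.ip (S.lorentz (γ τ) w) (G τ)) • G τ := by
    intro τ hτ w hw
    rw [S.anisoLorentz_of_ip_eq_zero (hG1 τ hτ) (by rw [S.ip_smul_right, hw, mul_zero]),
      S.ip_smul_right, smul_smul]
    congr 2
    rw [hk]
    field_simp
  have hDtW : ∀ τ ∈ T, S.twistedDeriv s γ T (fun τ ↦ S.perp (G τ) (J τ)) τ = U τ := by
    intro τ hτ
    rw [twistedDeriv, S.covDeriv_congr hperp hτ, ← hG, hperp τ hτ, haniso τ hτ _ (hWG τ hτ)]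
    simp only [hUdef, hb]
    module
  -- The component `⟨DW, G⟩ = k b s² = b` comes from `f'`; the two correction terms of `U` remove
  -- `b/2` each.
  have hUG : ∀ τ ∈ T, S.ip (U τ) (G τ) = 0 := by
    intro τ hτ
    have h1 : S.ip (S.covDeriv γ T J τ) (G τ) = 0 := hnormal τ hτ
    have h2 : S.ip (S.lorentz (γ τ) (W τ)) (G τ) = b τ := rfl
    simp only [hUdef, hDW τ hτ, S.ip_add_left, S.ip_smul_left, S.ip_lorentz_self, hGG τ hτ, h1, h2]
    linear_combination (1 / 2 * b τ) * hks
  intro t ht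
  have hDLW := S.covDeriv_lorentz hγs hU hWs ht
  have hb' := S.hasDerivWithinAt_ip hγs hU hLWs hGs ht
  rw [hDLW, hDG t ht, S.ip_add_left] at hb'
  set b' : ℝ := S.ip (S.nablaLorentz (γ t) (velocity γ T t) (W t)) (G t)
    + S.ip (S.lorentz (γ t) (S.covDeriv γ T W t)) (G t)
    + S.ip (S.lorentz (γ t) (W t)) (S.lorentz (γ t) (G t)) with hb'def
  -- The term `k b ΩG` appears twice: once from `f'`, once from `DG = ΩG`.
  have hDDW : S.covDeriv γ T (S.covDeriv γ T W) t = S.covDeriv γ T (S.covDeriv γ T J) t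
      + (f t • (S.nablaLorentz (γ t) (G t) (G t) + S.lorentz (γ t) (S.lorentz (γ t) (G t)))
        + (k * b t) • S.lorentz (γ t) (G t)
        + ((k * b t) • S.lorentz (γ t) (G t) + (k * b') • G t)) := by
    have hkb : ContDiffOn ℝ ∞ (fun τ ↦ k * b τ) T := contDiffOn_const.mul hbs
    rw [S.covDeriv_congr hDW ht,
      S.covDeriv_add hU hDJs ((hLGs.smul hγs hfs).add hγs (hGs.smul hγs hkb)) ht,
      S.covDeriv_add hU (hLGs.smul hγs hfs) (hGs.smul hγs hkb) ht,
      S.covDeriv_smul hU hLGs (hf' t ht) ht, S.covDeriv_smul hU hGs (hb'.const_mul k) ht,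
      S.covDeriv_lorentz hγs hU hGs ht, hDG t ht]
  have hDU : S.covDeriv γ T U t = S.covDeriv γ T (S.covDeriv γ T W) t
      + ((-(1 / 2) : ℝ) • (S.nablaLorentz (γ t) (G t) (W t)
          + S.lorentz (γ t) (S.covDeriv γ T W t))
        + ((-(1 / 2) * k * b t) • S.lorentz (γ t) (G t) + (-(1 / 2) * k * b') • G t)) := by
    have hkb : ContDiffOn ℝ ∞ (fun τ ↦ -(1 / 2) * k * b τ) T := contDiffOn_const.mul hbs
    have hLWs' := hLWs.smul hγs (contDiffOn_const (c := (-(1 / 2) : ℝ)))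
    rw [hUdef, S.covDeriv_add hU hDWs (hLWs'.add hγs (hGs.smul hγs hkb)) ht,
      S.covDeriv_add hU hLWs' (hGs.smul hγs hkb) ht, S.covDeriv_const_smul hU hLWs _ ht,
      S.covDeriv_smul hU hGs (hb'.const_mul (-(1 / 2) * k)) ht, hDLW, hDG t ht]
  -- Eliminates `DJ` in favour of `DW`; the `Ω²G` term produced here cancels the one in `hDDW`.
  have hLDJ : S.lorentz (γ t) (S.covDeriv γ T J t) = S.lorentz (γ t) (S.covDeriv γ T W t)
      - f t • S.lorentz (γ t) (S.lorentz (γ t) (G t)) - (k * b t) • S.lorentz (γ t) (G t) := by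
    rw [hDW t ht]
    simp only [map_add, map_smul]
    module
  have hJW : J t = W t + (-f t) • G t := by
    simp only [hW]
    module
  have hjac : S.covDeriv γ T (S.covDeriv γ T J) t + S.curvature (γ t) (W t) (G t) (G t)
      = S.nablaLorentz (γ t) (W t) (G t) + (-f t) • S.nablaLorentz (γ t) (G t) (G t)
        + S.lorentz (γ t) (S.covDeriv γ T J t) := by
    have h := hJ.eqn t ht
    rw [← hG] at h
    rwa [hJW, S.curvature_add_left, S.curvature_smul_left, curvature_self, smul_zero, add_zero,
      S.nablaLorentz_add_left, S.nablaLorentz_smul_left] at h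
  -- Skewness turns `-½⟨Ω²W, G⟩` into `+½⟨ΩW, ΩG⟩`, and `⟨ΩG, G⟩ = 0` removes the last term of `U`.
  have hLU : S.ip (S.lorentz (γ t) (U t)) (G t) = S.ip (S.lorentz (γ t) (S.covDeriv γ T W t)) (G t)
      + 1 / 2 * S.ip (S.lorentz (γ t) (W t)) (S.lorentz (γ t) (G t)) := by
    simp only [hUdef, map_add, map_smul, S.ip_add_left, S.ip_smul_left, S.ip_lorentz_self,
      S.ip_lorentz_left (S.lorentz (γ t) (W t))]
    ring
  have hbW : S.ip (W t) (S.lorentz (γ t) (G t)) = -b t := by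
    simp only [hb, S.ip_lorentz_left, neg_neg]
  rw [twistedDeriv, S.covDeriv_congr hDtW ht, hDtW t ht, ← hG, hperp t ht,
    haniso t ht _ (hUG t ht), hDU, hDDW, eq_sub_of_add_eq hjac, hLDJ, hLU,
    S.magCurvature_inv_smul hs.ne', hbW, hb'def, ← hG, ← hk]
  simp only [hUdef, map_add, map_smul]
  module

end MagneticSystem

end MagneticFlow

end

theorem proposition3p1 {E : Type*} [NormedAddCommGroup E] [NormedSpace ℝ E]
    [FiniteDimensional ℝ E]
    {M : Type*} [TopologicalSpace M] [ChartedSpace E M] [IsManifold 𝓘(ℝ, E) ∞ M]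
    (S : MagneticFlow.MagneticSystem E M)
    (T : Set ℝ) (hT : T.OrdConnected) (hT' : T.Nontrivial)
    (γ : ℝ → M) (hγ : S.IsMagneticGeodesic γ T)
    (s : ℝ) (hs : 0 < s) (hspeed : S.HasSpeed γ T s)
    (J : ∀ t, TangentSpace 𝓘(ℝ, E) (γ t))
    (hJ : S.IsMagneticJacobi γ T J) (hnormal : S.IsNormal γ T J) :
    ∀ t ∈ T,
      S.twistedDeriv s γ T
          (S.twistedDeriv s γ T
            (fun τ ↦ S.perp (MagneticFlow.MagneticSystem.velocity γ T τ) (J τ))) t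
        + S.magCurvature s (s⁻¹ • MagneticFlow.MagneticSystem.velocity γ T t)
            (S.perp (MagneticFlow.MagneticSystem.velocity γ T t) (J t)) = 0 :=
  -- A nondegenerate interval is convex with nonempty interior, so derivatives within it are unique,
  -- endpoints included.
  S.twistedDeriv_twistedDeriv_perp (uniqueDiffOn_convex hT.convex
    (hT.convex.nontrivial_iff_nonempty_interior.1 hT')) hγ hs hspeed hJ hnormal
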